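/- Let $\lambda>0$, $p\in(0,1]$ and $n\ge 0$. Let $\Phi=\sum_i\varepsilon_{X_i}$ be a homogeneous Poisson point process of intensity $\lambda$ on $\mathbb{R}^2$, whose points carry iid marks $\mathbf Z_i=(Z_{i,1},\dots,Z_{i,n})\in\{0,1\}^n$, independent of $\Phi$, with independent $\mathrm{Ber}(p)$ coordinates. Let $\mathbb{P}^{\mathbf 0}$ be the Palm probability of this stationary marked point process, given a point at the origin, and let $\mathbb{P}^{(\mathbf 0,\mathbf 1)}$ be $\mathbb{P}^{\mathbf 0}$ conditioned on the point at the origin having mark $\mathbf 1=(1,\dots,1)$. For each packet $j\in\{1,\dots,n\}$ let $\Phi_j^+$ and $\Phi_j^-$ be the sets of points whose $j$-th mark coordinate is $1$ and $0$, respectively. Let $C_j^+$ be the infinite cluster of the graph on $\Phi_j^+$ that joins distinct points at Euclidean distance at most $1$, that is, the set of the vertices whose connected component is infinite (if $\lambda p$ exceeds the critical intensity $\lambda_c$, this is almost surely the unique infinite connected component). The infinite extended cluster (IEC) of packet $j$ is $$C_j^{\mathrm{ext}}=C_j^+\cup\{v\in\Phi_j^- : B_1(v)\cap C_j^+\neq\emptyset\},$$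 where $B_1(v)$ is the closed unit ball around $v$. For $k\ge 0$ let $C_{k,n}^{\mathrm{ext}}$ be the set of points of the process that lie in at least $k$ of the $n$ IECs, and put $\theta_{k,n}^{\mathrm{ext}}=\mathbb{P}^{\mathbf 0}(\mathbf 0\in C_{k,n}^{\mathrm{ext}})$. For $T\subseteq[n]=\{1,\dots,n\}$ let $A_T^{\mathrm{ext}}$ be the event that the origin is in the IEC of packet $j$ for exactly those $j$ that belong to $T$, and let $[t]=\{1,\dots,t\}$. Then, for every $0\le t\le n$ and every $T\subseteq[n]$ with $|T|=t$, $$\mathbb{P}^{(\mathbf 0,\mathbf 1)}\big(A_{T}^{\mathrm{ext}}\big)=\mathbb{P}^{(\mathbf 0,\mathbf 1)}\big(A_{[t]}^{\mathrm{ext}}\big)=\begin{cases}\dfrac{\theta_{t,n}^{\mathrm{ext}}-\theta_{t+1,n}^{\mathrm{ext}}}{\binom nt}, & 0\le t\le n-1,\\[2mm] \theta_{n,n}^{\mathrm{ext}}, & t=n.\end{cases}$$ -/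

import Mathlib

open MeasureTheory ProbabilityTheory
open scoped NNReal ENNReal unitInterval

noncomputable section

namespace Forwarding

/-- The Euclidean plane. -/
abbrev Plane : Type := EuclideanSpace ℝ (Fin 2)

/-- Mark vectors `(z_1, …, z_n) ∈ {0,1}^n`, with `true` for `1` (the node transmits the packet). -/
abbrev Mark (n : ℕ) : Type := Fin n → Bool

/-! ### Deterministic part: random geometric graphs and extended clusters -/

/-- The random geometric graph with vertex set `S` and distance threshold `1`. It is written as a
graph on the whole plane in which the points outside `S` are isolated. -/
def rgg (S : Set Plane) : SimpleGraph Plane where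
  Adj x y := x ∈ S ∧ y ∈ S ∧ x ≠ y ∧ dist x y ≤ 1
  symm.symm _ _ h := ⟨h.2.1, h.1, h.2.2.1.symm, by rw [dist_comm]; exact h.2.2.2⟩
  loopless.irrefl _ h := h.2.2.1 rfl

/-- The connected component (cluster) of the vertex `x` in the random geometric graph on `S`. -/
def cluster (S : Set Plane) (x : Plane) : Set Plane :=
  {y | y ∈ S ∧ (rgg S).Reachable x y}

/-- The infinite cluster of the random geometric graph on `S`: the vertices whose cluster is
infinite. It is empty if there is no infinite cluster. -/
def infiniteCluster (S : Set Plane) : Set Plane :=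
  {x | x ∈ S ∧ (cluster S x).Infinite}

/-- The points of the marked configuration `φ` with mark `1` for the packet `j`. -/
def plusPart {n : ℕ} (φ : Set (Plane × Mark n)) (j : Fin n) : Set Plane :=
  {x | ∃ z : Mark n, (x, z) ∈ φ ∧ z j = true}

/-- The points of the marked configuration `φ` with mark `0` for the packet `j`. -/
def minusPart {n : ℕ} (φ : Set (Plane × Mark n)) (j : Fin n) : Set Plane :=
  {x | ∃ z : Mark n, (x, z) ∈ φ ∧ z j = false}

/-- The boundary of a set `S` of transmitting nodes of the packet `j`: the nodes that do not
transmit the packet and have a point of `S` in their closed unit ball. -/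
def boundary {n : ℕ} (φ : Set (Plane × Mark n)) (j : Fin n) (S : Set Plane) : Set Plane :=
  {v | v ∈ minusPart φ j ∧ (Metric.closedBall v 1 ∩ S).Nonempty}

/-- The infinite extended cluster (IEC) of the packet `j`. -/
def iec {n : ℕ} (φ : Set (Plane × Mark n)) (j : Fin n) : Set Plane :=
  infiniteCluster (plusPart φ j) ∪ boundary φ j (infiniteCluster (plusPart φ j))

/-- The nodes which are in at least `k` of the `n` IECs. -/
def extAtLeast {n : ℕ} (φ : Set (Plane × Mark n)) (k : ℕ) : Set Plane :=
  {x | k ≤ {j : Fin n | x ∈ iec φ j}.ncard}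

/-! ### Probabilistic part: Poisson processes, iid marks, Palm probability -/

/-- The number of points of the sequence `X` in the set `B`. -/
def count {Ω : Type*} (X : ℕ → Ω → Plane) (B : Set Plane) (ω : Ω) : ℕ∞ :=
  {i : ℕ | X i ω ∈ B}.encard

/-- `Φ = ∑ i, ε_{X i}` is a homogeneous Poisson point process of intensity `lam` on the plane:
the number of points in a Borel set of finite area is Poisson with mean `lam` times the area, and
the numbers of points in finitely many disjoint Borel sets are independent. -/
structure IsPoissonProcess {Ω : Type*} [MeasurableSpace Ω] (P : Measure Ω) (lam : ℝ≥0)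
    (X : ℕ → Ω → Plane) : Prop where
  measurable : ∀ i, Measurable (X i)
  law : ∀ B : Set Plane, MeasurableSet B → volume B ≠ ∞ → ∀ k : ℕ,
    P {ω | count X B ω = k} = poissonMeasure (lam * (volume B).toNNReal) {k}
  indep : ∀ (m : ℕ) (B : Fin m → Set Plane), (∀ i, MeasurableSet (B i)) →
    Pairwise (fun i j => Disjoint (B i) (B j)) → iIndepFun (fun i => count X (B i)) P

/-- The law of the mark of a node: `n` independent `Ber(p)` coordinates. -/
def markLaw (n : ℕ) (p : I) : Measure (Mark n) :=
  Measure.pi fun _ => bernoulliMeasure true false p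

/-- `∑ i, ε_{(X i, Z i)}` is an iid marked Poisson process with intensity `lam` and mark
distribution `markLaw n p`: the marks are iid, and independent of the points. -/
structure IsMarkedPoissonProcess {Ω : Type*} [MeasurableSpace Ω] (P : Measure Ω) (lam : ℝ≥0)
    {n : ℕ} (p : I) (X : ℕ → Ω → Plane) (Z : ℕ → Ω → Mark n) : Prop where
  poisson : IsPoissonProcess P lam X
  measurable_mark : ∀ i, Measurable (Z i)
  law_mark : ∀ i, P.map (Z i) = markLaw n p
  iIndep_mark : iIndepFun Z P
  indep_points : IndepFun (fun ω i => X i ω) (fun ω i => Z i ω) P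

/-- Enumerated marked configurations; such a sequence `s` stands for the set `Set.range s` of
marked points. -/
abbrev Config (n : ℕ) : Type := ℕ → Plane × Mark n

/-- The unit square `[-1/2, 1/2]²`. -/
def unitSquare : Set Plane := {x | ∀ i, x i ∈ Set.Icc (-(1 / 2) : ℝ) (1 / 2)}

/-- The Palm probability `P⁰` of the stationary marked point process `∑ i, ε_{(X i, Z i)}` of
intensity `lam`, as a law on pairs (mark of the point at the origin, marked configuration):
`P⁰(A) = lam⁻¹ * E[∑_{i : X i ∈ [-1/2,1/2]²} 1_A (Z i, configuration shifted by - X i)]`. -/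
def palm {Ω : Type*} [MeasurableSpace Ω] (P : Measure Ω) (lam : ℝ≥0) {n : ℕ}
    (X : ℕ → Ω → Plane) (Z : ℕ → Ω → Mark n) : Measure (Mark n × Config n) :=
  (lam : ℝ≥0∞)⁻¹ • Measure.sum fun i =>
    (P.restrict {ω | X i ω ∈ unitSquare}).map
      fun ω => (Z i ω, fun j => (X j ω - X i ω, Z j ω))

/-- The Palm probability `P^{(0,1)}`, conditional on the origin having mark `(1, …, 1)`. -/
def palmOne {Ω : Type*} [MeasurableSpace Ω] (P : Measure Ω) (lam : ℝ≥0) {n : ℕ}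
    (X : ℕ → Ω → Plane) (Z : ℕ → Ω → Mark n) : Measure (Mark n × Config n) :=
  ProbabilityTheory.cond (palm P lam X Z) {q | q.1 = fun _ => true}

/-- `θ^ext_{k,n}`: the Palm probability `P⁰` that the origin is in at least `k` of the `n` IECs. -/
def thetaExt {Ω : Type*} [MeasurableSpace Ω] (P : Measure Ω) (lam : ℝ≥0) {n : ℕ}
    (X : ℕ → Ω → Plane) (Z : ℕ → Ω → Mark n) (k : ℕ) : ℝ :=
  (palm P lam X Z).real {q | (0 : Plane) ∈ extAtLeast (Set.range q.2) k}

/-- `A^ext_T`: the origin is in exactly the IECs of the packets in `T`. -/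
def extEvent {n : ℕ} (T : Finset (Fin n)) : Set (Mark n × Config n) :=
  {q | ∀ j : Fin n, (0 : Plane) ∈ iec (Set.range q.2) j ↔ j ∈ T}

/-- The first `t` packets (the packets are numbered from `0` to `n - 1` here). -/
def firstPackets (n t : ℕ) : Finset (Fin n) := Finset.univ.filter fun j => (j : ℕ) < t

end Forwarding

end

namespace Forwarding

/-! ### Infinite clusters and removal of a vertex -/

/-! Two symmetries carry the proof. First, the origin's own mark is irrelevant to its membership in
an IEC. In a locally finite configuration, a transmitting node has an infinite cluster exactly when
one of its neighbours lies in an infinite cluster of the graph without that node; for a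
non-transmitting node the same condition is the definition of the boundary (`mem_iec_iff`). Hence
under the Palm probability the events `extEvent T` are independent of the origin's mark, and
conditioning on the mark (1, …, 1) changes nothing (`palmOne_extEvent`). This needs the points to be
almost surely distinct and locally finite, which is derived from the Poisson law.

Second, the coordinates of the marks are exchangeable, so the Palm probability of `extEvent T`
depends only on the size of `T` (`palm_extEvent_of_card_eq`). The difference of two consecutive
values of `thetaExt` is the probability of being in exactly `t` IECs, a disjoint union of `n.choose
t` such equiprobable events. -/

theorem rgg_mono {S S' : Set Plane} (h : S ⊆ S') : rgg S ≤ rgg S' :=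
  fun _ _ hxy => ⟨h hxy.1, h hxy.2.1, hxy.2.2⟩

theorem cluster_mono {S S' : Set Plane} (h : S ⊆ S') (x : Plane) : cluster S x ⊆ cluster S' x :=
  fun _ hy => ⟨h hy.1, hy.2.mono (rgg_mono h)⟩

/-- A vertex in the cluster of `v` is `v` itself or is connected to a neighbour of `v` by a path
that avoids `v`. -/
theorem cluster_subset_insert_biUnion (S : Set Plane) (v : Plane) :
    cluster S v ⊆
      insert v (⋃ y ∈ (S \ {v}) ∩ Metric.closedBall v 1, cluster (S \ {v}) y) := by
  rintro w ⟨-, hw⟩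
  rw [SimpleGraph.reachable_iff_reflTransGen] at hw
  induction hw with
  | refl => exact Set.mem_insert _ _
  | @tail b c _ hbc ih =>
    by_cases hc : c = v
    · exact hc ▸ Set.mem_insert _ _
    refine Set.mem_insert_of_mem _ ?_
    obtain ⟨hb, hcS, hne, hd⟩ := hbc
    rcases ih with rfl | ih
    · refine Set.mem_biUnion (x := c) ⟨⟨hcS, hc⟩, ?_⟩ ⟨⟨hcS, hc⟩, SimpleGraph.Reachable.refl _⟩
      rwa [Metric.mem_closedBall, dist_comm]
    · simp only [Set.mem_iUnion] at ih
      obtain ⟨y, hy, hby, hr⟩ := ih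
      refine Set.mem_biUnion hy ⟨⟨hcS, hc⟩, hr.trans (SimpleGraph.Adj.reachable ?_)⟩
      exact ⟨hby, ⟨hcS, hc⟩, hne, hd⟩

/-- Deleting `v` breaks its cluster into finitely many pieces, each containing a neighbour of `v`,
so an infinite cluster leaves an infinite piece. Conversely, an edge joins `v` to any infinite piece
that meets its unit ball. -/
theorem cluster_infinite_iff_of_finite_degree {S : Set Plane} {v : Plane} (hv : v ∈ S)
    (hfin : (S ∩ Metric.closedBall v 1).Finite) :
    (cluster S v).Infinite ↔
      (Metric.closedBall v 1 ∩ infiniteCluster (S \ {v})).Nonempty := by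
  constructor
  · intro h
    by_contra hne
    refine h (Set.Finite.subset (Set.Finite.insert v (Set.Finite.biUnion (hfin.subset ?_) ?_))
      (cluster_subset_insert_biUnion S v))
    · exact Set.inter_subset_inter_left _ Set.sdiff_subset
    · intro y hy
      by_contra hinf
      exact hne ⟨y, hy.2, hy.1, hinf⟩
  · rintro ⟨y, hyv, hyS, hy⟩
    refine (hy.mono (cluster_mono Set.sdiff_subset y)).mono ?_
    rintro w ⟨hwS, hw⟩
    refine ⟨hwS, SimpleGraph.Reachable.trans (SimpleGraph.Adj.reachable ?_) hw⟩
    exact ⟨hv, hyS.1, fun h => hyS.2 h.symm, by rwa [dist_comm]⟩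

/-- Membership of a node in an infinite extended cluster is determined by the other nodes. -/
theorem mem_iec_iff {n : ℕ} {φ : Set (Plane × Mark n)} {v : Plane} {z : Mark n}
    (hz : (v, z) ∈ φ) (hu : ∀ z', (v, z') ∈ φ → z' = z) (j : Fin n)
    (hfin : (plusPart φ j ∩ Metric.closedBall v 1).Finite) :
    v ∈ iec φ j ↔ (Metric.closedBall v 1 ∩ infiniteCluster (plusPart φ j \ {v})).Nonempty := by
  -- If the mark is 0, deleting `v` does nothing and the right side defines the boundary; if it is
  -- 1, the vertex-removal criterion applies. Uniqueness of the mark keeps `v` out of the other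
  -- part.
  cases hj : z j
  · have h1 : v ∉ plusPart φ j := by
      rintro ⟨z', hz', hj'⟩
      simp [hu z' hz', hj] at hj'
    have h2 : v ∈ minusPart φ j := ⟨z, hz, hj⟩
    rw [Set.sdiff_singleton_eq_self h1]
    simp [iec, boundary, infiniteCluster, h1, h2]
  · have h1 : v ∈ plusPart φ j := ⟨z, hz, hj⟩
    have h2 : v ∉ minusPart φ j := by
      rintro ⟨z', hz', hj'⟩
      simp [hu z' hz', hj] at hj'
    rw [← cluster_infinite_iff_of_finite_degree h1 hfin]
    simp [iec, boundary, infiniteCluster, h1, h2]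

/-- The marked configuration with points `x` and marks `z`, seen from the point `x i`. -/
def seenFrom {n : ℕ} (x : ℕ → Plane) (i : ℕ) (z : ℕ → Mark n) : Config n :=
  fun k => (x k - x i, z k)

/-- The criterion `mem_iec_iff` reads only the nodes other than the origin, and the update touches
only index `i`. Injectivity ensures that the origin carries a single mark. -/
theorem zero_mem_iec_seenFrom_update {n : ℕ} {x : ℕ → Plane} (hx : Function.Injective x) {i : ℕ}
    (hfin : {k | x k ∈ Metric.closedBall (x i) 1}.Finite) (z : ℕ → Mark n) (a : Mark n)
    (j : Fin n) :
    (0 : Plane) ∈ iec (Set.range (seenFrom x i (Function.update z i a))) j ↔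
      (0 : Plane) ∈ iec (Set.range (seenFrom x i z)) j := by
  have key : ∀ z : ℕ → Mark n, (0 : Plane) ∈ iec (Set.range (seenFrom x i z)) j ↔
      (Metric.closedBall (0 : Plane) 1 ∩
        infiniteCluster (plusPart (Set.range (seenFrom x i z)) j \ {0})).Nonempty := by
    intro z
    refine mem_iec_iff (z := z i) (Set.mem_range.2 ⟨i, by simp [seenFrom]⟩) ?_ j ?_
    · rintro z' ⟨k, hk⟩
      simp only [seenFrom, Prod.mk.injEq, sub_eq_zero] at hk
      rw [← hk.2, hx hk.1]
    · refine (hfin.image fun k => x k - x i).subset ?_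
      rintro y ⟨⟨z', ⟨k, hk⟩, -⟩, hy⟩
      simp only [seenFrom, Prod.mk.injEq] at hk
      refine ⟨k, ?_, hk.1⟩
      simpa [← hk.1, dist_eq_norm] using hy
  have hplus : plusPart (Set.range (seenFrom x i (Function.update z i a))) j \ {0} =
      plusPart (Set.range (seenFrom x i z)) j \ {0} := by
    ext y
    simp only [plusPart, seenFrom, Set.mem_range, Prod.mk.injEq, Set.mem_sdiff, Set.mem_ofPred_eq,
      Set.mem_singleton_iff, and_congr_left_iff]
    intro hy
    refine exists_congr fun z' => and_congr_left fun _ => exists_congr fun k =>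
      and_congr_right fun hk => ?_
    have hki : k ≠ i := by
      rintro rfl
      exact hy (by rw [← hk, sub_self])
    rw [Function.update_of_ne hki]
  rw [key, key, hplus]

/-! ### Relabelling the packets -/

theorem iec_range_permute {n : ℕ} (e : Equiv.Perm (Fin n)) (x : ℕ → Plane) (i : ℕ)
    (z : ℕ → Mark n) (j : Fin n) :
    iec (Set.range (seenFrom x i fun k => z k ∘ e)) j =
      iec (Set.range (seenFrom x i z)) (e j) := by
  have h1 : plusPart (Set.range (seenFrom x i fun k => z k ∘ e)) j =
      plusPart (Set.range (seenFrom x i z)) (e j) := by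
    ext y; simp [plusPart, seenFrom]
  have h2 : minusPart (Set.range (seenFrom x i fun k => z k ∘ e)) j =
      minusPart (Set.range (seenFrom x i z)) (e j) := by
    ext y; simp [minusPart, seenFrom]
  simp only [iec, boundary, h1, h2]

/-- The first components `a` and `b` are arbitrary because `extEvent` reads only the configuration.
-/
theorem mem_extEvent_permute {n : ℕ} (e : Equiv.Perm (Fin n)) (x : ℕ → Plane) (i : ℕ)
    (z : ℕ → Mark n) (a b : Mark n) (T : Finset (Fin n)) :
    (a, seenFrom x i fun k => z k ∘ e) ∈ extEvent T ↔
      (b, seenFrom x i z) ∈ extEvent (T.map e.toEmbedding) := by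
  simp only [extEvent, Set.mem_ofPred_eq, iec_range_permute]
  refine Equiv.forall_congr e fun j => ?_
  simp

/-! ### Measurability of the events -/

/-- Every node is a term of the sequence, so quantifiers over points become countable ones over
indices. Repeated points are allowed here, so the mark 1 may come from another index `k`. -/
theorem measurableSet_mem_plusPart {n : ℕ} (j : Fin n) (a : ℕ) :
    MeasurableSet {s : Config n | (s a).1 ∈ plusPart (Set.range s) j} := by
  have : {s : Config n | (s a).1 ∈ plusPart (Set.range s) j} =
      ⋃ k, {s : Config n | (s k).1 = (s a).1} ∩ {s : Config n | (s k).2 j = true} := by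
    ext s
    simp only [plusPart, Set.mem_range, Set.mem_ofPred_eq, Set.mem_iUnion, Set.mem_inter_iff]
    constructor
    · rintro ⟨z, ⟨k, hk⟩, hz⟩
      exact ⟨k, by rw [hk], by rw [hk]; exact hz⟩
    · rintro ⟨k, hk, hz⟩
      exact ⟨_, ⟨k, by rw [← hk]⟩, hz⟩
  rw [this]
  refine MeasurableSet.iUnion fun k => (measurableSet_eq_fun ?_ ?_).inter ?_
  · fun_prop
  · fun_prop
  · exact measurableSet_eq_fun (by fun_prop) measurable_const

theorem measurableSet_adj {n : ℕ} (j : Fin n) (a b : ℕ) :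
    MeasurableSet {s : Config n | (rgg (plusPart (Set.range s) j)).Adj (s a).1 (s b).1} := by
  refine (measurableSet_mem_plusPart j a).inter ((measurableSet_mem_plusPart j b).inter
    (MeasurableSet.inter ?_ ?_))
  · exact (measurableSet_eq_fun (f := fun s : Config n => (s a).1) (by fun_prop)
      (g := fun s : Config n => (s b).1) (by fun_prop)).compl
  · exact measurableSet_le (f := fun s : Config n => dist (s a).1 (s b).1) (by fun_prop)
      measurable_const

/-- The points `(s a).1` and `(s b).1` are joined by a path of length `N`. -/
def joinedIn {n : ℕ} (j : Fin n) (s : Config n) (a : ℕ) : ℕ → ℕ → Prop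
  | 0, b => (s a).1 = (s b).1
  | N + 1, b => ∃ c, joinedIn j s a N c ∧ (rgg (plusPart (Set.range s) j)).Adj (s c).1 (s b).1

theorem measurableSet_joinedIn {n : ℕ} (j : Fin n) (a N b : ℕ) :
    MeasurableSet {s : Config n | joinedIn j s a N b} := by
  induction N generalizing b with
  | zero => exact measurableSet_eq_fun (by fun_prop) (by fun_prop)
  | succ N ih =>
    simp only [joinedIn, Set.ofPred_exists]
    exact MeasurableSet.iUnion fun c => (ih c).inter (measurableSet_adj j c b)

theorem reachable_iff_exists_joinedIn {n : ℕ} (j : Fin n) (s : Config n) (a b : ℕ) :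
    (rgg (plusPart (Set.range s) j)).Reachable (s a).1 (s b).1 ↔ ∃ N, joinedIn j s a N b := by
  constructor
  · intro h
    rw [SimpleGraph.reachable_iff_reflTransGen] at h
    generalize hy : (s b).1 = y at h
    induction h generalizing b with
    | refl => exact ⟨0, hy.symm⟩
    | @tail c y _ hcy ih =>
      -- An endpoint of an edge is a node, hence has an index `k`.
      obtain ⟨⟨z, ⟨k, hk⟩, -⟩, -⟩ := hcy.1, trivial
      obtain ⟨N, hN⟩ := ih k (by rw [hk])
      exact ⟨N + 1, k, hN, by rw [hk, hy]; exact hcy⟩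
  · rintro ⟨N, hN⟩
    induction N generalizing b with
    | zero => exact (show (s a).1 = (s b).1 from hN) ▸ SimpleGraph.Reachable.refl _
    | succ N ih =>
      obtain ⟨c, hc, hcb⟩ := hN
      exact (ih c hc).trans hcb.reachable

/-- A subset of the range of a sequence is infinite if and only if it is not covered by finitely
many terms of the sequence. -/
theorem infinite_iff_forall_finset_exists {α : Type*} {u : ℕ → α} {C : Set α}
    (hC : C ⊆ Set.range u) :
    C.Infinite ↔ ∀ F : Finset ℕ, ∃ k, u k ∈ C ∧ ∀ l ∈ F, u k ≠ u l := by
  constructor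
  · intro h F
    obtain ⟨y, hy, hyF⟩ := h.exists_notMem_finite (F.finite_toSet.image u)
    obtain ⟨k, rfl⟩ := hC hy
    exact ⟨k, hy, fun l hl hkl => hyF ⟨l, hl, hkl.symm⟩⟩
  · intro h hfin
    have hC' : ∀ y ∈ C, ∃ k, u k = y := fun y hy => hC hy
    choose! g hg using hC'
    obtain ⟨k, hk, hkF⟩ := h (hfin.toFinset.image g)
    exact hkF (g (u k)) (Finset.mem_image_of_mem g (hfin.mem_toFinset.2 hk)) (hg _ hk).symm

/-- Infinitude is tested against the countably many finite sets of indices. -/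
theorem measurableSet_mem_infiniteCluster {n : ℕ} (j : Fin n) (a : ℕ) :
    MeasurableSet {s : Config n | (s a).1 ∈ infiniteCluster (plusPart (Set.range s) j)} := by
  have hsub : ∀ s : Config n, cluster (plusPart (Set.range s) j) (s a).1 ⊆
      Set.range fun k => (s k).1 := by
    rintro s y ⟨⟨z, ⟨k, hk⟩, -⟩, -⟩
    exact ⟨k, by simp [hk]⟩
  have heq : {s : Config n | (s a).1 ∈ infiniteCluster (plusPart (Set.range s) j)} =
      {s : Config n | (s a).1 ∈ plusPart (Set.range s) j} ∩ ⋂ F : Finset ℕ, ⋃ k,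
        ({s : Config n | (s k).1 ∈ plusPart (Set.range s) j} ∩
          ⋃ N, {s : Config n | joinedIn j s a N k}) ∩
        ⋂ l ∈ F, {s : Config n | (s k).1 ≠ (s l).1} := by
    ext s
    simp only [infiniteCluster, Set.mem_ofPred_eq, infinite_iff_forall_finset_exists (hsub s)]
    simp only [cluster, Set.mem_ofPred_eq, reachable_iff_exists_joinedIn, Set.mem_inter_iff,
      Set.mem_iInter, Set.mem_iUnion]
  rw [heq]
  refine (measurableSet_mem_plusPart j a).inter ?_
  refine MeasurableSet.iInter fun F => MeasurableSet.iUnion fun k =>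
    ((measurableSet_mem_plusPart j k).inter
      (MeasurableSet.iUnion fun N => measurableSet_joinedIn j a N k)).inter
    (F.measurableSet_biInter fun l _ => ?_)
  exact (measurableSet_eq_fun (f := fun s : Config n => (s k).1) (by fun_prop)
      (g := fun s : Config n => (s l).1) (by fun_prop)).compl

theorem measurableSet_zero_mem_iec {n : ℕ} (j : Fin n) :
    MeasurableSet {s : Config n | (0 : Plane) ∈ iec (Set.range s) j} := by
  have hzero : ∀ a, MeasurableSet {s : Config n | (s a).1 = 0} := fun a =>
    measurableSet_eq_fun (by fun_prop) measurable_const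
  have : {s : Config n | (0 : Plane) ∈ iec (Set.range s) j} =
      (⋃ a, {s : Config n | (s a).1 = 0} ∩
        {s : Config n | (s a).1 ∈ infiniteCluster (plusPart (Set.range s) j)}) ∪
      ((⋃ a, {s : Config n | (s a).1 = 0} ∩ {s : Config n | (s a).2 j = false}) ∩
        ⋃ b, {s : Config n | dist (s b).1 0 ≤ 1} ∩
          {s : Config n | (s b).1 ∈ infiniteCluster (plusPart (Set.range s) j)}) := by
    ext s
    simp only [iec, boundary, Set.mem_ofPred_eq, Set.mem_union, Set.mem_iUnion, Set.mem_inter_iff]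
    refine or_congr ⟨fun h => ?_, ?_⟩ (and_congr ⟨?_, ?_⟩ ⟨?_, ?_⟩)
    · obtain ⟨z, ⟨k, hk⟩, -⟩ := h.1
      exact ⟨k, by rw [hk], by rw [hk]; exact h⟩
    · rintro ⟨a, ha, h⟩
      rwa [← ha]
    · rintro ⟨z, ⟨k, hk⟩, hz⟩
      exact ⟨k, by rw [hk], by rw [hk]; exact hz⟩
    · rintro ⟨k, hk, hz⟩
      exact ⟨_, ⟨k, by rw [← hk]⟩, hz⟩
    · rintro ⟨y, hy, h⟩
      obtain ⟨z, ⟨k, hk⟩, -⟩ := h.1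
      exact ⟨k, by rw [hk]; exact hy, by rw [hk]; exact h⟩
    · rintro ⟨b, hb, h⟩
      exact ⟨_, hb, h⟩
  rw [this]
  refine (MeasurableSet.iUnion fun a => (hzero a).inter
    (measurableSet_mem_infiniteCluster j a)).union
    ((MeasurableSet.iUnion fun a => (hzero a).inter ?_).inter
      (MeasurableSet.iUnion fun b => MeasurableSet.inter ?_
        (measurableSet_mem_infiniteCluster j b)))
  · exact measurableSet_eq_fun (by fun_prop) measurable_const
  · exact measurableSet_le (by fun_prop) measurable_const

theorem measurableSet_extEvent {n : ℕ} (T : Finset (Fin n)) :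
    MeasurableSet (extEvent T : Set (Mark n × Config n)) := by
  have h : ∀ j : Fin n, MeasurableSet
      {q : Mark n × Config n | (0 : Plane) ∈ iec (Set.range q.2) j} := fun j =>
    measurable_snd (measurableSet_zero_mem_iec j)
  simp only [extEvent, Set.ofPred_forall]
  refine MeasurableSet.iInter fun j => ?_
  by_cases hj : j ∈ T
  · simpa [hj] using h j
  · simp only [hj, iff_false]
    exact (h j).compl

/-! ### Poisson processes: mean number of points, local finiteness, simplicity -/

theorem count_eq_tsum {Ω : Type*} (X : ℕ → Ω → Plane) (B : Set Plane) (ω : Ω) :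
    (count X B ω : ℝ≥0∞) = ∑' i, (X i ⁻¹' B).indicator 1 ω := by
  rw [count, ← ENNReal.tsum_set_one]
  exact tsum_subtype {i | X i ω ∈ B} fun _ => (1 : ℝ≥0∞)

section Poisson

variable {Ω : Type*} [MeasurableSpace Ω] {P : Measure Ω} {lam : ℝ≥0} {X : ℕ → Ω → Plane}

theorem measurable_count (hX : ∀ i, Measurable (X i)) {B : Set Plane} (hB : MeasurableSet B) :
    Measurable fun ω => (count X B ω : ℝ≥0∞) := by
  simp only [count_eq_tsum]
  exact Measurable.tsum fun i => measurable_one.indicator (hX i hB)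

theorem measurableSet_count_eq (hX : ∀ i, Measurable (X i)) {B : Set Plane}
    (hB : MeasurableSet B) (k : ℕ) : MeasurableSet {ω | count X B ω = k} := by
  have : {ω | count X B ω = k} = (fun ω => (count X B ω : ℝ≥0∞)) ⁻¹' {(k : ℝ≥0∞)} := by
    ext ω
    simp only [Set.mem_ofPred_eq, Set.mem_preimage, Set.mem_singleton_iff]
    rw [← ENat.toENNReal_coe, ENat.toENNReal_inj]
  rw [this]
  exact measurable_count hX hB (measurableSet_singleton _)

/-- The law prescribes only the probabilities of finite counts; as these sum to 1, an infinite count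
has probability 0. -/
theorem IsPoissonProcess.ae_count_lt_top [IsProbabilityMeasure P] (h : IsPoissonProcess P lam X)
    {B : Set Plane} (hB : MeasurableSet B) (hvol : volume B ≠ ∞) :
    ∀ᵐ ω ∂P, count X B ω < ⊤ := by
  have hU : {ω | count X B ω < ⊤} = ⋃ k : ℕ, {ω | count X B ω = k} := by
    ext ω
    simp only [Set.mem_ofPred_eq, Set.mem_iUnion, lt_top_iff_ne_top, ENat.ne_top_iff_exists]
    exact exists_congr fun k => eq_comm
  have hm : MeasurableSet {ω | count X B ω < ⊤} := by
    rw [hU]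
    exact MeasurableSet.iUnion (measurableSet_count_eq h.measurable hB)
  refine (mem_ae_iff_prob_eq_one hm).2 ?_
  rw [hU, measure_iUnion]
  · simp_rw [h.law B hB hvol]
    rw [← measure_iUnion, Set.iUnion_of_singleton, measure_univ]
    · intro i j hij
      simpa using hij
    · exact fun _ => measurableSet_singleton _
  · intro i j hij
    refine Set.disjoint_left.2 fun ω (hi : count X B ω = i) (hj : count X B ω = j) => hij ?_
    exact_mod_cast hi.symm.trans hj
  · exact measurableSet_count_eq h.measurable hB

theorem tsum_mul_poissonMeasure_singleton (r : ℝ≥0) :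
    ∑' k : ℕ, (k : ℝ≥0∞) * poissonMeasure r {k} = r := by
  have hstep : ∀ k : ℕ, ((k + 1 : ℕ) : ℝ≥0∞) * poissonMeasure r {k + 1} =
      r * poissonMeasure r {k} := by
    intro k
    rw [poissonMeasure_singleton, poissonMeasure_singleton, ← ENNReal.ofReal_natCast,
      ← ENNReal.ofReal_coe_nnreal (p := r), ← ENNReal.ofReal_mul (by positivity),
      ← ENNReal.ofReal_mul (by positivity), Nat.factorial_succ]
    congr 1
    push_cast
    field_simp
    ring
  have hone : ∑' k : ℕ, poissonMeasure r {k} = 1 := by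
    rw [← measure_iUnion (fun i j hij => by simpa using hij)
      (fun _ => measurableSet_singleton _), Set.iUnion_of_singleton, measure_univ]
  rw [tsum_eq_zero_add' ENNReal.summable]
  simp_rw [hstep]
  rw [ENNReal.tsum_mul_left, hone]
  simp

/-- Both sides are the expected number of points in `B`. For the unit square this gives the Palm
measure total mass 1. -/
theorem IsPoissonProcess.tsum_measure_mem [IsProbabilityMeasure P] (h : IsPoissonProcess P lam X)
    {B : Set Plane} (hB : MeasurableSet B) (hvol : volume B ≠ ∞) :
    ∑' i, P {ω | X i ω ∈ B} = lam * volume B := by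
  have h1 : ∑' i, P {ω | X i ω ∈ B} = ∫⁻ ω, (count X B ω : ℝ≥0∞) ∂P := by
    simp only [count_eq_tsum]
    rw [lintegral_tsum fun i => (measurable_one.indicator (h.measurable i hB)).aemeasurable]
    refine tsum_congr fun i => ?_
    rw [lintegral_indicator_one (h.measurable i hB)]
    rfl
  have h2 : ∀ᵐ ω ∂P, (count X B ω : ℝ≥0∞) =
      ∑' k : ℕ, {ω | count X B ω = k}.indicator (fun _ => (k : ℝ≥0∞)) ω := by
    filter_upwards [h.ae_count_lt_top hB hvol] with ω hω
    obtain ⟨m, hm⟩ := ENat.ne_top_iff_exists.1 hω.ne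
    rw [tsum_eq_single m, Set.indicator_of_mem (by exact hm.symm), ← hm, ENat.toENNReal_coe]
    intro k hk
    refine Set.indicator_of_notMem (s := {ω | count X B ω = k})
      (fun hmem : count X B ω = k => hk ?_) _
    exact_mod_cast (hm.trans hmem).symm
  rw [h1, lintegral_congr_ae h2, lintegral_tsum fun k => (measurable_const.indicator
    (measurableSet_count_eq h.measurable hB k)).aemeasurable]
  simp_rw [lintegral_indicator_const (measurableSet_count_eq h.measurable hB _),
    h.law B hB hvol]
  rw [tsum_mul_poissonMeasure_singleton, ENNReal.coe_mul, ENNReal.coe_toNNReal hvol]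

/-- `count` counts indices, so a coincidence inside `B` forces a count of at least 2, which for a
Poisson variable of mean `r` has probability at most `r ^ 2`. -/
theorem IsPoissonProcess.measure_mem_and_eq_le [IsProbabilityMeasure P]
    (h : IsPoissonProcess P lam X) {i j : ℕ} (hij : i ≠ j)
    {B : Set Plane} (hB : MeasurableSet B) (hvol : volume B ≠ ∞) :
    P {ω | X i ω ∈ B ∧ X i ω = X j ω} ≤ (lam * volume B) ^ 2 := by
  have hX := h.measurable
  set r : ℝ≥0 := lam * (volume B).toNNReal with hr
  have hrB : (lam : ℝ≥0∞) * volume B = r := by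
    rw [hr, ENNReal.coe_mul, ENNReal.coe_toNNReal hvol]
  set D := {ω | X i ω ∈ B ∧ X i ω = X j ω}
  set U := {ω | count X B ω = (0 : ℕ)} ∪ {ω | count X B ω = (1 : ℕ)} with hU
  have hUm : MeasurableSet U :=
    (measurableSet_count_eq hX hB 0).union (measurableSet_count_eq hX hB 1)
  have hDU : D ⊆ Uᶜ := by
    rintro ω ⟨hi, hE⟩
    have h2 : 1 < count X B ω :=
      Set.one_lt_encard_iff.2 ⟨i, j, hi, by simpa [← hE] using hi, hij⟩
    rintro (h0 | h1)
    · rw [show count X B ω = (0 : ℕ) from h0] at h2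
      exact absurd h2 (by simp)
    · rw [show count X B ω = (1 : ℕ) from h1] at h2
      exact absurd h2 (by simp)
  have hUr : P.real U = Real.exp (-r) * (1 + r) := by
    have hd : Disjoint {ω | count X B ω = (0 : ℕ)} {ω | count X B ω = (1 : ℕ)} := by
      refine Set.disjoint_left.2 fun ω (h0 : count X B ω = (0 : ℕ))
        (h1 : count X B ω = (1 : ℕ)) => ?_
      simp [h0] at h1
    rw [hU, measureReal_union hd (measurableSet_count_eq hX hB 1), measureReal_def,
      measureReal_def, h.law B hB hvol, h.law B hB hvol, ← measureReal_def, ← measureReal_def,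
      poissonMeasure_real_singleton, poissonMeasure_real_singleton]
    simp only [← hr, pow_zero, pow_one, Nat.factorial_zero, Nat.factorial_one, Nat.cast_one]
    ring
  calc P D ≤ P Uᶜ := measure_mono hDU
    _ = ENNReal.ofReal (P.real Uᶜ) := by simp
    _ ≤ ENNReal.ofReal ((r : ℝ) ^ 2) := by
      refine ENNReal.ofReal_le_ofReal ?_
      rw [probReal_compl_eq_one_sub hUm, hUr]
      -- From exp(-r) ≥ 1 - r one gets 1 - exp(-r)(1 + r) ≤ 1 - (1 - r)(1 + r) = r².
      have := Real.add_one_le_exp (-(r : ℝ))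
      nlinarith [r.coe_nonneg]
    _ = (lam * volume B) ^ 2 := by
      rw [hrB, ENNReal.ofReal_pow r.coe_nonneg, ENNReal.ofReal_coe_nnreal]

/-- A finite measure on the plane that is quadratically small in the area vanishes. -/
theorem measure_eq_zero_of_le_sq (ν : Measure Plane) [IsFiniteMeasure ν] (c : ℝ≥0)
    (hac : ν ≪ volume)
    (hν : ∀ x r, ν (Metric.closedBall x r) ≤ (c * volume (Metric.closedBall x r)) ^ 2) :
    ν = 0 := by
  -- At almost every `x` the density is the limit of the ratios ν(B)/vol(B) over shrinking balls,
  -- and these are at most c² vol(B), which tends to 0.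
  have hzero : ν.rnDeriv volume =ᵐ[volume] 0 := by
    filter_upwards [Besicovitch.ae_tendsto_rnDeriv ν (volume : Measure Plane)] with x hx
    have hvol : Filter.Tendsto (fun r => volume (Metric.closedBall x r))
        (nhdsWithin 0 (Set.Ioi 0)) (nhds 0) := by
      have hc := (tendsto_measure_cthickening_of_isCompact (μ := (volume : Measure Plane))
        (isCompact_singleton (x := x))).mono_left
        (nhdsWithin_le_nhds (s := Set.Ioi (0 : ℝ)))
      rw [measure_singleton] at hc
      refine hc.congr' ?_
      filter_upwards [self_mem_nhdsWithin] with r hr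
      rw [Metric.cthickening_singleton x (le_of_lt hr)]
    have hlim : Filter.Tendsto
        (fun r => (c : ℝ≥0∞) ^ 2 * volume (Metric.closedBall x r))
        (nhdsWithin 0 (Set.Ioi 0)) (nhds 0) := by
      simpa using ENNReal.Tendsto.const_mul hvol
        (Or.inr (ENNReal.pow_ne_top ENNReal.coe_ne_top : (c : ℝ≥0∞) ^ 2 ≠ ∞))
    refine tendsto_nhds_unique hx (tendsto_of_tendsto_of_tendsto_of_le_of_le
      tendsto_const_nhds hlim (fun _ => zero_le) fun r => ENNReal.div_le_of_le_mul ?_)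
    refine (hν x r).trans (le_of_eq ?_)
    ring
  rw [← Measure.withDensity_rnDeriv_eq ν volume hac, withDensity_congr_ae hzero]
  simp

/-- For `i ≠ j`, the law of the position of `X i` on the event `X i = X j` is bounded by the squared
mean count, so `measure_eq_zero_of_le_sq` makes it vanish. -/
theorem IsPoissonProcess.ae_injective [IsProbabilityMeasure P] (h : IsPoissonProcess P lam X) :
    ∀ᵐ ω ∂P, Function.Injective fun i => X i ω := by
  have hX := h.measurable
  suffices hne : ∀ i j, i ≠ j → ∀ᵐ ω ∂P, X i ω ≠ X j ω by
    have : ∀ᵐ ω ∂P, ∀ i j, i ≠ j → X i ω ≠ X j ω := by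
      simp only [ae_all_iff]
      exact hne
    filter_upwards [this] with ω hω i j hij
    by_contra hc
    exact hω i j hc hij
  intro i j hij
  have hE : MeasurableSet {ω | X i ω = X j ω} := measurableSet_eq_fun (hX i) (hX j)
  set ν := (P.restrict {ω | X i ω = X j ω}).map (X i) with hνdef
  have hνB : ∀ B, MeasurableSet B → ν B = P {ω | X i ω ∈ B ∧ X i ω = X j ω} := by
    intro B hB
    rw [hνdef, Measure.map_apply (hX i) hB, Measure.restrict_apply (hX i hB)]
    rfl
  have hν0 : ν = 0 := by
    refine measure_eq_zero_of_le_sq ν lam (Measure.AbsolutelyContinuous.mk fun B hB hvol => ?_)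
      fun x r => ?_
    · have := h.measure_mem_and_eq_le hij hB (by simp [hvol])
      rw [hνB B hB]
      simpa [hvol] using this
    · rw [hνB _ measurableSet_closedBall]
      exact h.measure_mem_and_eq_le hij measurableSet_closedBall measure_closedBall_lt_top.ne
  have := hνB Set.univ MeasurableSet.univ
  rw [hν0] at this
  rw [ae_iff]
  simpa using this.symm

/-- The ball has a random centre, so it is enclosed in one of countably many fixed balls around 0.
-/
theorem IsPoissonProcess.ae_finite_closedBall [IsProbabilityMeasure P]
    (h : IsPoissonProcess P lam X) :
    ∀ᵐ ω ∂P, ∀ i, {k | X k ω ∈ Metric.closedBall (X i ω) 1}.Finite := by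
  have : ∀ᵐ ω ∂P, ∀ N : ℕ, count X (Metric.closedBall 0 N) ω < ⊤ := by
    rw [ae_all_iff]
    exact fun N => h.ae_count_lt_top measurableSet_closedBall measure_closedBall_lt_top.ne
  filter_upwards [this] with ω hω i
  obtain ⟨N, hN⟩ := exists_nat_ge (1 + ‖X i ω‖)
  refine (Set.encard_lt_top_iff.1 (hω N)).subset fun k hk => ?_
  refine Metric.closedBall_subset_closedBall' ?_ hk
  simpa using hN

end Poisson

theorem measurableSet_unitSquare : MeasurableSet unitSquare := by
  simp only [unitSquare, Set.ofPred_forall]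
  exact MeasurableSet.iInter fun i =>
    (show Measurable fun x : Plane => x i by fun_prop) measurableSet_Icc

theorem volume_unitSquare : volume unitSquare = 1 := by
  have h : unitSquare = (WithLp.ofLp : Plane → Fin 2 → ℝ) ⁻¹'
      (Set.univ.pi fun _ => Set.Icc (-(1 / 2) : ℝ) (1 / 2)) := by
    ext x
    simp only [unitSquare, Set.mem_ofPred_eq, Set.mem_preimage, Set.mem_univ_pi]
  rw [h, (PiLp.volume_preserving_ofLp (Fin 2)).measure_preimage
    (MeasurableSet.univ_pi fun _ => measurableSet_Icc).nullMeasurableSet, volume_pi_pi]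
  norm_num [Real.volume_Icc]

/-! ### The law of the marks -/

instance isProbabilityMeasure_markLaw (n : ℕ) (p : I) : IsProbabilityMeasure (markLaw n p) := by
  unfold markLaw
  infer_instance

theorem markLaw_singleton_true_ne_zero (n : ℕ) {p : I} (hp : 0 < p) :
    markLaw n p {fun _ => true} ≠ 0 := by
  rw [markLaw, Measure.pi_singleton, Finset.prod_ne_zero_iff]
  intro j _
  rw [bernoulliMeasure_apply_of_mem_of_notMem p (measurableSet_singleton _) (by simp) (by simp)]
  exact_mod_cast (show unitInterval.toNNReal p ≠ 0 from
    fun h0 => hp.ne' (Subtype.ext (congrArg NNReal.toReal h0)))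

theorem markLaw_map_permute {n : ℕ} (p : I) (e : Equiv.Perm (Fin n)) :
    (markLaw n p).map (fun z => z ∘ e) = markLaw n p := by
  have : MeasurePreserving (fun z : Mark n => z ∘ e) (markLaw n p) (markLaw n p) :=
    measurePreserving_arrowCongr' _ _ e.symm (MeasurableEquiv.refl Bool) fun _ =>
      MeasurePreserving.id _
  exact this.map_eq

/-- The law of the sequence of the marks of all nodes. -/
noncomputable def markSeqLaw (n : ℕ) (p : I) : Measure (ℕ → Mark n) :=
  Measure.infinitePi fun _ => markLaw n p

instance isProbabilityMeasure_markSeqLaw (n : ℕ) (p : I) :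
    IsProbabilityMeasure (markSeqLaw n p) := by
  unfold markSeqLaw
  infer_instance

theorem measurePreserving_permute_markSeqLaw {n : ℕ} (p : I) (e : Equiv.Perm (Fin n)) :
    MeasurePreserving (fun (z : ℕ → Mark n) k => z k ∘ e) (markSeqLaw n p) (markSeqLaw n p) := by
  have hm : Measurable fun z : Mark n => z ∘ e :=
    measurable_pi_lambda _ fun j => measurable_pi_apply (e j)
  refine ⟨measurable_pi_lambda _ fun k => hm.comp (measurable_pi_apply k), ?_⟩
  have := Measure.infinitePi_map_pi (fun _ : ℕ => markLaw n p) fun _ : ℕ => hm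
  simp only [markLaw_map_permute] at this
  exact this

/-- An event that does not depend on the mark of the node `i` is independent of this mark. -/
theorem markSeqLaw_inter_of_update {n : ℕ} (p : I) (i : ℕ) {F : Set (ℕ → Mark n)}
    (hF : MeasurableSet F) (hupd : ∀ z a, Function.update z i a ∈ F ↔ z ∈ F) (a : Mark n) :
    markSeqLaw n p ({z | z i = a} ∩ F) = markLaw n p {a} * markSeqLaw n p F := by
  have hind : iIndepFun (fun (k : ℕ) (z : ℕ → Mark n) => z k) (markSeqLaw n p) :=
    iIndepFun_infinitePi (X := fun _ z => z) fun _ => measurable_id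
  have hle : ∀ k : ℕ, MeasurableSpace.comap (fun z : ℕ → Mark n => z k) inferInstance ≤
      (inferInstance : MeasurableSpace (ℕ → Mark n)) := fun k => (measurable_pi_apply k).comap_le
  have hsup := indep_iSup_of_disjoint hle hind (S := {i}) (T := {i}ᶜ) disjoint_compl_right
  have h1 : MeasurableSet[⨆ k ∈ ({i} : Set ℕ),
      MeasurableSpace.comap (fun z : ℕ → Mark n => z k) inferInstance] {z | z i = a} := by
    have hi : MeasurableSpace.comap (fun z : ℕ → Mark n => z i) inferInstance ≤
        ⨆ k ∈ ({i} : Set ℕ), MeasurableSpace.comap (fun z : ℕ → Mark n => z k) inferInstance :=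
      le_iSup₂_of_le i rfl le_rfl
    exact hi _ ⟨{a}, measurableSet_singleton _, rfl⟩
  have h2 : MeasurableSet[⨆ k ∈ ({i}ᶜ : Set ℕ),
      MeasurableSpace.comap (fun z : ℕ → Mark n => z k) inferInstance] F := by
    -- Overwriting coordinate `i` by a constant is measurable with respect to the other coordinates,
    -- and `F` is its own preimage under this map.
    have hg : Measurable[⨆ k ∈ ({i}ᶜ : Set ℕ),
        MeasurableSpace.comap (fun z : ℕ → Mark n => z k) inferInstance]
        (fun z : ℕ → Mark n => Function.update z i a) := by
      refine @measurable_pi_lambda _ _ _ (_) _ _ fun k => ?_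
      by_cases hk : k = i
      · subst hk
        simp only [Function.update_self]
        exact @measurable_const _ _ _ (_) _
      · simp only [Function.update_of_ne hk]
        exact Measurable.mono (comap_measurable _) (le_iSup₂_of_le k hk le_rfl) le_rfl
    have := hg hF
    rwa [show (fun z : ℕ → Mark n => Function.update z i a) ⁻¹' F = F from
      Set.ext fun z => hupd z a] at this
  rw [(Indep_iff _ _ _).1 hsup _ _ h1 h2]
  congr 1
  exact (measurePreserving_eval_infinitePi (fun _ : ℕ => markLaw n p) i).measure_preimage
    (measurableSet_singleton a).nullMeasurableSet

/-! ### The Palm probability -/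

section Palm

variable {Ω : Type*} [MeasurableSpace Ω] {P : Measure Ω} [IsProbabilityMeasure P] {n : ℕ}
  {lam : ℝ≥0} {p : I} {X : ℕ → Ω → Plane} {Z : ℕ → Ω → Mark n}

theorem IsMarkedPoissonProcess.map_eq_prod (h : IsMarkedPoissonProcess P lam p X Z) :
    P.map (fun ω => ((fun i => X i ω), fun i => Z i ω)) =
      (P.map fun ω i => X i ω).prod (markSeqLaw n p) := by
  have hX : Measurable fun ω i => X i ω := measurable_pi_lambda _ h.poisson.measurable
  have hZ : Measurable fun ω i => Z i ω := measurable_pi_lambda _ h.measurable_mark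
  rw [(indepFun_iff_map_prod_eq_prod_map_map hX.aemeasurable hZ.aemeasurable).1 h.indep_points,
    h.iIndep_mark.map_fun_eq_infinitePi_map h.measurable_mark]
  simp only [h.law_mark]
  rfl

theorem measurable_seenFrom (x : ℕ → Plane) (i : ℕ) :
    Measurable fun z : ℕ → Mark n => (z i, seenFrom x i z) := by
  unfold seenFrom
  fun_prop

/-- The Palm probability, with the marks integrated out for given points. -/
theorem IsMarkedPoissonProcess.palm_apply (h : IsMarkedPoissonProcess P lam p X Z)
    {A : Set (Mark n × Config n)} (hA : MeasurableSet A) :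
    palm P lam X Z A = (lam : ℝ≥0∞)⁻¹ * ∑' i, ∫⁻ ω in {ω | X i ω ∈ unitSquare},
      markSeqLaw n p {z | (z i, seenFrom (fun k => X k ω) i z) ∈ A} ∂P := by
  have hXm := h.poisson.measurable
  have hZm := h.measurable_mark
  have hX : Measurable fun ω i => X i ω := measurable_pi_lambda _ hXm
  have hZ : Measurable fun ω i => Z i ω := measurable_pi_lambda _ hZm
  rw [palm, Measure.smul_apply, Measure.sum_apply _ hA, smul_eq_mul]
  congr 1
  refine tsum_congr fun i => ?_
  have hf : Measurable fun ω => (Z i ω, fun j => (X j ω - X i ω, Z j ω)) := by fun_prop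
  have hsq : MeasurableSet {ω | X i ω ∈ unitSquare} := hXm i measurableSet_unitSquare
  set E : Set ((ℕ → Plane) × (ℕ → Mark n)) :=
    {q | q.1 i ∈ unitSquare} ∩ {q | (q.2 i, seenFrom q.1 i q.2) ∈ A} with hE
  have hEm : MeasurableSet E := by
    refine MeasurableSet.inter ?_ ?_
    · exact (show Measurable fun q : (ℕ → Plane) × (ℕ → Mark n) => q.1 i by fun_prop)
        measurableSet_unitSquare
    · refine (show Measurable fun q : (ℕ → Plane) × (ℕ → Mark n) =>
        (q.2 i, seenFrom q.1 i q.2) from ?_) hA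
      unfold seenFrom
      fun_prop
  calc ((P.restrict {ω | X i ω ∈ unitSquare}).map
        fun ω => (Z i ω, fun j => (X j ω - X i ω, Z j ω))) A
      = P.map (fun ω => ((fun i => X i ω), fun i => Z i ω)) E := by
        rw [Measure.map_apply hf hA, Measure.restrict_apply (hf hA),
          Measure.map_apply (hX.prodMk hZ) hEm, Set.inter_comm]
        rfl
    _ = ∫⁻ ω, markSeqLaw n p (Prod.mk (fun k => X k ω) ⁻¹' E) ∂P := by
        rw [h.map_eq_prod, Measure.prod_apply hEm,
          lintegral_map (measurable_measure_prodMk_left hEm) hX]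
    _ = _ := by
        rw [← lintegral_indicator hsq]
        refine lintegral_congr fun ω => ?_
        by_cases hω : X i ω ∈ unitSquare
        · rw [Set.indicator_of_mem (by exact hω)]
          congr 1
          ext z
          simp [hE, hω]
        · rw [Set.indicator_of_notMem (by exact hω)]
          have : Prod.mk (fun k => X k ω) ⁻¹' E = ∅ := by
            ext z
            simp [hE, hω]
          rw [this, measure_empty]

theorem IsMarkedPoissonProcess.palm_univ (h : IsMarkedPoissonProcess P lam p X Z)
    (hlam : 0 < lam) : palm P lam X Z Set.univ = 1 := by
  have hmean := h.poisson.tsum_measure_mem measurableSet_unitSquare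
    (by simp [volume_unitSquare])
  rw [h.palm_apply MeasurableSet.univ]
  simp only [Set.mem_univ, Set.ofPred_true, measure_univ, lintegral_one,
    Measure.restrict_apply_univ]
  rw [hmean, volume_unitSquare, mul_one]
  exact ENNReal.inv_mul_cancel (by simpa using hlam.ne') ENNReal.coe_ne_top

theorem IsMarkedPoissonProcess.isProbabilityMeasure_palm
    (h : IsMarkedPoissonProcess P lam p X Z) (hlam : 0 < lam) :
    IsProbabilityMeasure (palm P lam X Z) :=
  ⟨h.palm_univ hlam⟩

/-- Under the Palm probability, the mark of the origin is independent of every event that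
almost surely does not depend on this mark. -/
theorem IsMarkedPoissonProcess.palm_mark_inter (h : IsMarkedPoissonProcess P lam p X Z)
    {A : Set (Mark n × Config n)} (hA : MeasurableSet A) (a : Mark n)
    (hupd : ∀ᵐ ω ∂P, ∀ i z b,
      (Function.update z i b i, seenFrom (fun k => X k ω) i (Function.update z i b)) ∈ A ↔
        (z i, seenFrom (fun k => X k ω) i z) ∈ A) :
    palm P lam X Z ({q | q.1 = a} ∩ A) = markLaw n p {a} * palm P lam X Z A := by
  have ha : MeasurableSet {q : Mark n × Config n | q.1 = a} :=
    measurable_fst (measurableSet_singleton a)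
  rw [h.palm_apply (ha.inter hA), h.palm_apply hA, mul_left_comm,
    ← ENNReal.tsum_mul_left (a := markLaw n p {a})]
  congr 1
  refine tsum_congr fun i => ?_
  rw [← lintegral_const_mul' _ _ (measure_ne_top _ _)]
  refine lintegral_congr_ae (ae_restrict_of_ae ?_)
  filter_upwards [hupd] with ω hω
  exact markSeqLaw_inter_of_update p i (measurable_seenFrom (fun k => X k ω) i hA) (hω i) a

theorem IsMarkedPoissonProcess.ae_extEvent_update (h : IsMarkedPoissonProcess P lam p X Z)
    (T : Finset (Fin n)) :
    ∀ᵐ ω ∂P, ∀ i z b,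
      (Function.update z i b i, seenFrom (fun k => X k ω) i (Function.update z i b)) ∈
          extEvent T ↔ (z i, seenFrom (fun k => X k ω) i z) ∈ extEvent T := by
  filter_upwards [h.poisson.ae_injective, h.poisson.ae_finite_closedBall] with ω hinj hfin i z b
  exact forall_congr' fun j => iff_congr (zero_mem_iec_seenFrom_update hinj (hfin i) z b j) Iff.rfl

/-- The conditioning on the mark of the origin does not affect the extended clusters. -/
theorem IsMarkedPoissonProcess.palmOne_extEvent (h : IsMarkedPoissonProcess P lam p X Z)
    (hlam : 0 < lam) (hp : 0 < p) (T : Finset (Fin n)) :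
    palmOne P lam X Z (extEvent T) = palm P lam X Z (extEvent T) := by
  have hm : MeasurableSet {q : Mark n × Config n | q.1 = fun _ => true} :=
    measurable_fst (measurableSet_singleton _)
  -- Independence applied to the sure event gives the law of the origin's mark.
  have h1 : palm P lam X Z {q | q.1 = fun _ => true} = markLaw n p {fun _ => true} := by
    have := h.palm_mark_inter MeasurableSet.univ (fun _ => true)
      (Filter.Eventually.of_forall fun ω i z b => by simp)
    rwa [Set.inter_univ, h.palm_univ hlam, mul_one] at this
  rw [palmOne, cond_apply hm, h1,
    h.palm_mark_inter (measurableSet_extEvent T) _ (h.ae_extEvent_update T), ← mul_assoc,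
    ENNReal.inv_mul_cancel (markLaw_singleton_true_ne_zero n hp) (measure_ne_top _ _), one_mul]

/-- With the points fixed, permuting the coordinates of all marks simultaneously preserves their law
and carries one event to the other. -/
theorem IsMarkedPoissonProcess.palm_extEvent_map (h : IsMarkedPoissonProcess P lam p X Z)
    (T : Finset (Fin n)) (e : Equiv.Perm (Fin n)) :
    palm P lam X Z (extEvent (T.map e.toEmbedding)) = palm P lam X Z (extEvent T) := by
  rw [h.palm_apply (measurableSet_extEvent _), h.palm_apply (measurableSet_extEvent _)]
  congr 1
  refine tsum_congr fun i => lintegral_congr fun ω => ?_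
  refine Eq.trans ?_ ((measurePreserving_permute_markSeqLaw p e).measure_preimage
    (measurable_seenFrom (fun k => X k ω) i (measurableSet_extEvent T)).nullMeasurableSet)
  congr 1
  ext z
  exact (mem_extEvent_permute e (fun k => X k ω) i z _ _ T).symm

theorem IsMarkedPoissonProcess.palm_extEvent_of_card_eq (h : IsMarkedPoissonProcess P lam p X Z)
    {S T : Finset (Fin n)} (hST : S.card = T.card) :
    palm P lam X Z (extEvent S) = palm P lam X Z (extEvent T) := by
  -- A bijection from `S` to `T` extends to a permutation of all packets.
  let e : Equiv.Perm (Fin n) := (Finset.equivOfCardEq hST).extendSubtype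
  have he : S.map e.toEmbedding = T := by
    refine Finset.eq_of_subset_of_card_le (fun j hj => ?_) (by simp [hST])
    obtain ⟨k, hk, rfl⟩ := Finset.mem_map.1 hj
    exact (Finset.equivOfCardEq hST).extendSubtype_mem k hk
  rw [← he, h.palm_extEvent_map]

end Palm

/-! ### Counting the extended clusters of the origin -/

theorem ncard_iec_eq {n : ℕ} {T : Finset (Fin n)} {q : Mark n × Config n} (hq : q ∈ extEvent T) :
    {j : Fin n | (0 : Plane) ∈ iec (Set.range q.2) j}.ncard = T.card := by
  rw [← Set.ncard_coe_finset]
  congr 1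
  ext j
  exact hq j

theorem exists_mem_extEvent {n : ℕ} (q : Mark n × Config n) :
    ∃ T : Finset (Fin n), q ∈ extEvent T := by
  classical
  exact ⟨Finset.univ.filter fun j => (0 : Plane) ∈ iec (Set.range q.2) j, fun j => by simp⟩

theorem pairwise_disjoint_extEvent (n : ℕ) :
    Pairwise (Function.onFun Disjoint (extEvent : Finset (Fin n) → Set (Mark n × Config n))) := by
  intro S T hST
  refine Set.disjoint_left.2 fun q hS hT => hST ?_
  ext j
  exact (hS j).symm.trans (hT j)

theorem setOf_zero_mem_extAtLeast {n : ℕ} (k : ℕ) :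
    {q : Mark n × Config n | (0 : Plane) ∈ extAtLeast (Set.range q.2) k} =
      ⋃ T ∈ Finset.univ.filter fun T : Finset (Fin n) => k ≤ T.card, extEvent T := by
  ext q
  obtain ⟨T, hT⟩ := exists_mem_extEvent q
  simp only [extAtLeast, Set.mem_ofPred_eq, Finset.mem_filter, Finset.mem_univ, true_and,
    Set.mem_iUnion, exists_prop]
  constructor
  · intro hk
    exact ⟨T, by rwa [ncard_iec_eq hT] at hk, hT⟩
  · rintro ⟨S, hS, hq⟩
    rwa [ncard_iec_eq hq]

theorem thetaExt_eq_sum {Ω : Type*} [MeasurableSpace Ω] (P : Measure Ω) {n : ℕ} (lam : ℝ≥0)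
    (X : ℕ → Ω → Plane) (Z : ℕ → Ω → Mark n) [IsFiniteMeasure (palm P lam X Z)] (k : ℕ) :
    thetaExt P lam X Z k = ∑ T ∈ Finset.univ.filter fun T : Finset (Fin n) => k ≤ T.card,
      (palm P lam X Z).real (extEvent T) := by
  rw [thetaExt, setOf_zero_mem_extAtLeast, measureReal_biUnion_finset]
  · exact fun S _ T _ hST => pairwise_disjoint_extEvent n hST
  · exact fun T _ => measurableSet_extEvent T

/-- The sets of at least `t` packets are those of exactly `t` and those of at least `t + 1`. -/
theorem thetaExt_eq_add {Ω : Type*} [MeasurableSpace Ω] (P : Measure Ω) {n : ℕ} (lam : ℝ≥0)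
    (X : ℕ → Ω → Plane) (Z : ℕ → Ω → Mark n) [IsFiniteMeasure (palm P lam X Z)] (t : ℕ) :
    thetaExt P lam X Z t = ∑ T ∈ Finset.powersetCard t (Finset.univ : Finset (Fin n)),
      (palm P lam X Z).real (extEvent T) + thetaExt P lam X Z (t + 1) := by
  rw [thetaExt_eq_sum, thetaExt_eq_sum, ← Finset.sum_union]
  · congr 1
    ext T
    simp only [Finset.mem_filter, Finset.mem_univ, true_and, Finset.mem_union,
      Finset.mem_powersetCard_univ]
    omega
  · rw [Finset.disjoint_left]
    intro T h1 h2
    simp only [Finset.mem_filter, Finset.mem_univ, true_and, Finset.mem_powersetCard_univ] at h1 h2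
    omega

theorem card_firstPackets {n t : ℕ} (ht : t ≤ n) : (firstPackets n t).card = t := by
  simp [firstPackets, Fin.card_filter_val_lt, ht]

end Forwarding

theorem proposition1 {Ω : Type*} [MeasurableSpace Ω] (P : Measure Ω) [IsProbabilityMeasure P]
    (n : ℕ) (lam : ℝ≥0) (hlam : 0 < lam) (p : I) (hp : 0 < p)
    (X : ℕ → Ω → Forwarding.Plane) (Z : ℕ → Ω → Forwarding.Mark n)
    (hXZ : Forwarding.IsMarkedPoissonProcess P lam p X Z) (t : ℕ) :
    (t < n →
      (Forwarding.palmOne P lam X Z).real (Forwarding.extEvent (Forwarding.firstPackets n t)) =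
        (Forwarding.thetaExt P lam X Z t - Forwarding.thetaExt P lam X Z (t + 1)) /
          (n.choose t : ℝ)) ∧
    (t = n →
      (Forwarding.palmOne P lam X Z).real (Forwarding.extEvent (Forwarding.firstPackets n t)) =
        Forwarding.thetaExt P lam X Z n) ∧
    (∀ T : Finset (Fin n), T.card = t →
      (Forwarding.palmOne P lam X Z).real (Forwarding.extEvent T) =
        (Forwarding.palmOne P lam X Z).real
          (Forwarding.extEvent (Forwarding.firstPackets n t))) := by
  have hprob := hXZ.isProbabilityMeasure_palm hlam
  have hone : ∀ T, (Forwarding.palmOne P lam X Z).real (Forwarding.extEvent T) =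
      (Forwarding.palm P lam X Z).real (Forwarding.extEvent T) := fun T => by
    rw [measureReal_def, measureReal_def, hXZ.palmOne_extEvent hlam hp]
  have hcard : t ≤ n → ∀ T : Finset (Fin n), T.card = t →
      (Forwarding.palm P lam X Z).real (Forwarding.extEvent T) =
        (Forwarding.palm P lam X Z).real
          (Forwarding.extEvent (Forwarding.firstPackets n t)) := fun ht T hT => by
    rw [measureReal_def, measureReal_def,
      hXZ.palm_extEvent_of_card_eq (hT.trans (Forwarding.card_firstPackets ht).symm)]
  have hsum : t ≤ n → Forwarding.thetaExt P lam X Z t = n.choose t *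
      (Forwarding.palm P lam X Z).real (Forwarding.extEvent (Forwarding.firstPackets n t)) +
        Forwarding.thetaExt P lam X Z (t + 1) := fun ht => by
    rw [Forwarding.thetaExt_eq_add, Finset.sum_congr rfl fun T hT =>
      hcard ht T (Finset.mem_powersetCard_univ.1 hT), Finset.sum_const,
      Finset.card_powersetCard, Finset.card_univ, Fintype.card_fin, nsmul_eq_mul]
  refine ⟨fun ht => ?_, ?_, fun T hT => ?_⟩
  · have hc : (n.choose t : ℝ) ≠ 0 := by exact_mod_cast (Nat.choose_pos ht.le).ne'
    rw [hone, hsum ht.le, eq_div_iff hc]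
    ring
  · rintro rfl
    -- No set of packets has `n + 1` elements, so the general recursion also covers `t = n`.
    have hempty : Forwarding.thetaExt P lam X Z (t + 1) = 0 := by
      rw [Forwarding.thetaExt_eq_sum]
      refine Finset.sum_eq_zero fun T hT => ?_
      have h1 := (Finset.mem_filter.1 hT).2
      have h2 := T.card_le_univ
      rw [Fintype.card_fin] at h2
      omega
    rw [hone, hsum le_rfl, hempty, Nat.choose_self]
    simp
  · have ht : t ≤ n := by
      rw [← hT]
      simpa using T.card_le_univ
    rw [hone, hone, hcard ht T hT]
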